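/- Let $\alpha>2$, $\tau>0$, $\lambda\ge 0$, $\lambda_{I,m}\ge 0$, $\hat P_I\ge 0$, $\hat P_N\ge 0$, and let $\mathcal A\subset\mathbb R^2$ be a Borel set of area $0<|\mathcal A|<\infty$. Let $b\in\mathbb R^2$ be a receiver with polar coordinates $(p_b,\theta_b)$, $p_b\ge 0$. Let the following random objects be independent: a source $i$ located uniformly on $\mathcal A$; its fading gain $h_i\sim\mathrm{Exp}(1)$; a homogeneous Poisson point process $\Phi$ on $\mathbb R^2$ of density $\lambda$ (active IoT devices); a sequence of i.i.d. $\mathrm{Exp}(1)$ fading gains $f_j$ attached to the points $j$ of $\Phi$; a homogeneous Poisson point process $\Phi_{I,m}$ on $\mathbb R^2$ of density $\lambda_{I,m}$ (active incumbent devices on band $m$); and a sequence of i.i.d. $\mathrm{Exp}(1)$ fading gains $g_{j'}$ attached to the points $j'$ of $\Phi_{I,m}$. Write $p_{i,b},p_{j,b},p_{j',b}$ for the distances to $b$, and set $$\mathrm{SINR}_{b,m}=\frac{h_i\,p_{i,b}^{-\alpha}}{\hat P_N+\sum_{j\in\Phi}f_j\,p_{j,b}^{-\alpha}+\sum_{j'\in\Phi_{I,m}}\hat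 P_I\,g_{j'}\,p_{j',b}^{-\alpha}}\in[0,\infty]$$ (which is $+\infty$ if the numerator is positive and the denominator is $0$). Let $$\epsilon_m=\pi\left(\lambda+\hat P_I^{2/\alpha}\lambda_{I,m}\right)\frac{2\pi/\alpha}{\sin(2\pi/\alpha)},\qquad \psi_m=\epsilon_m\,\tau^{2/\alpha}.$$ Then, for negligible noise, that is both for $\hat P_N=0$ and in the limit $\hat P_N\to 0^+$, the average decoding probability at $b$ is $$\Pr\left(\mathrm{SINR}_{b,m}\ge\tau\right)=\int_{\mathcal A}\exp\left(-\psi_m\,p_{i,b}^2\right)\frac{p_i}{|\mathcal A|}\,dp_i\,d\theta_i ,$$ where the integral converges and is taken over the polar coordinates $(p_i,\theta_i)$, $p_i>0$, $-\pi<\theta_i\le\pi$, of the points of $\mathcal A$, and where $p_{i,b}$, the distance between the points with polar coordinates $(p_i,\theta_i)$ and $(p_b,\theta_b)$, satisfies $p_{i,b}^2=p_i^2+p_b^2-2p_ip_b\cos(\theta_i-\theta_b)$. -/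

import Mathlib

open MeasureTheory ProbabilityTheory Filter Topology
open scoped NNReal ENNReal

noncomputable section

/-- The Euclidean plane. -/
abbrev Plane : Type := EuclideanSpace ℝ (Fin 2)

/-- The point of the plane with polar coordinates `(r, θ)`. -/
def polarPoint (r θ : ℝ) : Plane := !₂[r * Real.cos θ, r * Real.sin θ]

/-- The set of polar coordinates `(r, θ)`, `0 < r`, `-π < θ ≤ π`, of the points of `A`
(other than the origin). -/
def polarRegion (A : Set Plane) : Set (ℝ × ℝ) :=
  {q | 0 < q.1 ∧ q.2 ∈ Set.Ioc (-Real.pi) Real.pi ∧ polarPoint q.1 q.2 ∈ A}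

/-- The squared distance of the points with polar coordinates `(r, θ)` and `(r', θ')`, as given by
the law of cosines. -/
def cosineDistSq (r θ r' θ' : ℝ) : ℝ :=
  r ^ 2 + r' ^ 2 - 2 * r * r' * Real.cos (θ - θ')

/-- A finite or infinite sequence of points: `c.1` is the number of points, and the points are
`c.2 j` for `j < c.1` (the values `c.2 j` for `j ≥ c.1` carry no meaning). -/
abbrev PointSeq : Type := ℕ∞ × (ℕ → Plane)

/-- The number of points of `c` that lie in `A`. -/
def PointSeq.count (c : PointSeq) (A : Set Plane) : ℕ∞ :=
  {j : ℕ | (j : ℕ∞) < c.1 ∧ c.2 j ∈ A}.encard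

/-- `Φ` is a homogeneous Poisson point process on the plane with density `lam`: the number of points
in a bounded Borel set `A` is Poisson with mean `lam * |A|`, and the numbers of points in pairwise
disjoint bounded Borel sets are independent. -/
structure IsHPPP {Ω : Type*} [MeasurableSpace Ω] (lam : ℝ≥0) (Φ : Ω → PointSeq) (P : Measure Ω) :
    Prop where
  measurable : Measurable Φ
  hasLaw_count : ∀ A : Set Plane, MeasurableSet A → Bornology.IsBounded A →
    HasLaw (fun ω => (Φ ω).count A)
      ((poissonMeasure (lam * (volume A).toNNReal)).map (fun n : ℕ => (n : ℕ∞))) P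
  iIndepFun_count : ∀ (k : ℕ) (A : Fin k → Set Plane), (∀ i, MeasurableSet (A i)) →
    (∀ i, Bornology.IsBounded (A i)) → Pairwise (fun i j => Disjoint (A i) (A j)) →
    iIndepFun (fun i ω => (Φ ω).count (A i)) P

/-- The fading gains `f 0, f 1, …` are independent and exponentially distributed with mean `1`. -/
structure IsExpFading {Ω : Type*} [MeasurableSpace Ω] (f : Ω → ℕ → ℝ) (P : Measure Ω) : Prop where
  measurable : Measurable f
  hasLaw : ∀ j, HasLaw (fun ω => f ω j) (expMeasure 1) P
  iIndepFun : iIndepFun (fun j ω => f ω j) P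

/-- The power `∑ f_j p_{j,b} ^ (-α)` received at `b` from unit-power transmitters at the points of
`c`, where `p_{j,b}` is the distance of the `j`-th point to `b`. The sum is taken in `[0, ∞]`. -/
def receivedPower (α : ℝ) (b : Plane) (c : PointSeq) (f : ℕ → ℝ) : ℝ≥0∞ :=
  ∑' j : {j : ℕ // (j : ℕ∞) < c.1}, ENNReal.ofReal (f j) * edist (c.2 j) b ^ (-α)

/-- The SINR at `b` of a transmission from `u` with fading gain `h`, with relative noise power `PN`,
active devices `c` with fading gains `f`, and active incumbents `c'` of relative power `PI`
with fading gains `g`. -/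
def sinr (α : ℝ) (PN PI : ℝ≥0) (b u : Plane) (h : ℝ) (c : PointSeq) (f : ℕ → ℝ)
    (c' : PointSeq) (g : ℕ → ℝ) : ℝ≥0∞ :=
  ENNReal.ofReal h * edist u b ^ (-α) /
    (PN + receivedPower α b c f + PI * receivedPower α b c' g)

/-- The average decoding probability `Pr(SINR ≥ τ)` at `b` for a transmitter at the random
location `U`. -/
def adp {Ω : Type*} [MeasurableSpace Ω] (P : Measure Ω) (α τ : ℝ) (PN PI : ℝ≥0) (b : Plane)
    (U : Ω → Plane) (h : Ω → ℝ) (Φ : Ω → PointSeq) (f : Ω → ℕ → ℝ)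
    (ΦI : Ω → PointSeq) (g : Ω → ℕ → ℝ) : ℝ :=
  P.real {ω | ENNReal.ofReal τ ≤ sinr α PN PI b (U ω) (h ω) (Φ ω) (f ω) (ΦI ω) (g ω)}

/-- `ε = π (λ + PI ^ (2/α) λ_I) (2π/α) / sin (2π/α)`. -/
def epsCoeff (α : ℝ) (lam lamI PI : ℝ≥0) : ℝ :=
  Real.pi * ((lam : ℝ) + (PI : ℝ) ^ (2 / α) * (lamI : ℝ)) *
    ((2 * Real.pi / α) / Real.sin (2 * Real.pi / α))

/-- `ψ = ε τ ^ (2/α)`. -/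
def psiCoeff (α τ : ℝ) (lam lamI PI : ℝ≥0) : ℝ :=
  epsCoeff α lam lamI PI * τ ^ (2 / α)

/-- The integrand `exp (-ψ p_{i,b} ^ 2) p_i / |A|` in the polar coordinates `q = (p_i, θ_i)`
of the source, for a receiver with polar coordinates `(pb, θb)`. -/
def adpIntegrand (ψ : ℝ) (A : Set Plane) (pb θb : ℝ) (q : ℝ × ℝ) : ℝ :=
  Real.exp (-ψ * cosineDistSq q.1 q.2 pb θb) * (q.1 / volume.real A)

end

/-!
Given the geometry, the gain `h` of the source is exponential, so `SINR ≥ τ` has conditional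
probability `exp (-τ d ^ α (noise + interference))`, where `d` is the distance of the source to the
receiver; the decoding probability is thus governed by the Laplace transform of the interference.
Averaging first over the fading gains turns this transform into the Laplace functional of a Poisson
process, evaluated at `log (1 + s |x| ^ (-α))`, hence into the exponential of
`∫ s / (s + |x| ^ α) dx`. Since `s / (s + D)` is the Laplace transform at `D` of an exponential
variable of rate `s`, Tonelli's theorem and Euler's reflection formula evaluate this integral.
Dominated convergence gives the continuity in the noise power.
-/

section ExpNeg

/-- The decreasing exponential `x ↦ exp (-x)` on `[0, ∞]`, with value `0` at `∞`, in which all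
Laplace transforms are written. -/
noncomputable def expNeg (x : ℝ≥0∞) : ℝ≥0∞ := EReal.exp (-(x : EReal))

lemma continuous_expNeg : Continuous expNeg :=
  ENNReal.continuous_exp.comp (continuous_neg.comp continuous_coe_ennreal_ereal)

@[fun_prop]
lemma measurable_expNeg : Measurable expNeg := continuous_expNeg.measurable

lemma antitone_expNeg : Antitone expNeg := fun _ _ h =>
  EReal.exp_monotone (EReal.neg_le_neg_iff.2 (EReal.coe_ennreal_le_coe_ennreal_iff.2 h))

@[simp] lemma expNeg_zero : expNeg 0 = 1 := by simp [expNeg]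

@[simp] lemma expNeg_top : expNeg ⊤ = 0 := by simp [expNeg]

lemma expNeg_ofReal {x : ℝ} (hx : 0 ≤ x) :
    expNeg (ENNReal.ofReal x) = ENNReal.ofReal (Real.exp (-x)) := by
  rw [expNeg, EReal.coe_ennreal_ofReal, max_eq_left hx, ← EReal.coe_neg, EReal.exp_coe]

lemma expNeg_le_one (x : ℝ≥0∞) : expNeg x ≤ 1 := by
  simpa using antitone_expNeg (zero_le (a := x))

lemma expNeg_add (x y : ℝ≥0∞) : expNeg (x + y) = expNeg x * expNeg y := by
  rw [expNeg, EReal.coe_ennreal_add, EReal.neg_add (.inl (by simp)) (.inr (by simp)),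
    sub_eq_add_neg, EReal.exp_add, expNeg, expNeg]

lemma expNeg_sum {ι : Type*} (s : Finset ι) (x : ι → ℝ≥0∞) :
    expNeg (∑ i ∈ s, x i) = ∏ i ∈ s, expNeg (x i) := by
  classical
  induction s using Finset.induction_on with
  | empty => simp
  | insert a s ha ih => rw [Finset.sum_insert ha, Finset.prod_insert ha, expNeg_add, ih]

lemma expNeg_mul_natCast (x : ℝ≥0∞) (n : ℕ) : expNeg (x * n) = expNeg x ^ n := by
  simpa [mul_comm] using expNeg_sum (Finset.range n) (fun _ => x)

/-- The function `x ↦ log (1 + x)` on `[0, ∞]`: the exponent `y` with `exp (-y) = 1 / (1 + x)`. -/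
noncomputable def logOneAdd (x : ℝ≥0∞) : ℝ≥0∞ := (ENNReal.log (1 + x)).toENNReal

@[fun_prop]
lemma measurable_logOneAdd : Measurable logOneAdd :=
  (ENNReal.measurable_log.comp (measurable_const.add measurable_id)).ereal_toENNReal

lemma expNeg_logOneAdd (x : ℝ≥0∞) : expNeg (logOneAdd x) = (1 + x)⁻¹ := by
  rw [expNeg, logOneAdd, EReal.coe_toENNReal (ENNReal.zero_le_log_iff.2 le_self_add),
    EReal.exp_neg, ENNReal.exp_log]

variable {Ω : Type*} [MeasurableSpace Ω] {P : Measure Ω}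

lemma tendsto_lintegral_expNeg [IsFiniteMeasure P] {ι : Type*} {l : Filter ι}
    [l.IsCountablyGenerated] {F : ι → Ω → ℝ≥0∞} {G : Ω → ℝ≥0∞} (hF : ∀ i, Measurable (F i))
    (hlim : ∀ ω, Tendsto (fun i => F i ω) l (𝓝 (G ω))) :
    Tendsto (fun i => ∫⁻ ω, expNeg (F i ω) ∂P) l (𝓝 (∫⁻ ω, expNeg (G ω) ∂P)) :=
  tendsto_lintegral_filter_of_dominated_convergence (fun _ => 1)
    (Eventually.of_forall fun i => measurable_expNeg.comp (hF i))
    (Eventually.of_forall fun _ => Eventually.of_forall fun _ => expNeg_le_one _)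
    (by simp) (Eventually.of_forall fun ω => (continuous_expNeg.tendsto _).comp (hlim ω))

lemma lintegral_expNeg_sum {ι : Type*} {X : ι → Ω → ℝ≥0∞} (hX : ∀ i, Measurable (X i))
    (hind : iIndepFun X P) (s : Finset ι) :
    ∫⁻ ω, expNeg (∑ i ∈ s, X i ω) ∂P = ∏ i ∈ s, ∫⁻ ω, expNeg (X i ω) ∂P := by
  simp only [expNeg_sum]
  exact lintegral_prod_eq_prod_lintegral_of_indepFun s _
    (hind.comp (fun _ => expNeg) fun _ => measurable_expNeg)
    fun i => measurable_expNeg.comp (hX i)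

lemma lintegral_expNeg_tsum [IsFiniteMeasure P] {ι : Type*} [Countable ι] {X : ι → Ω → ℝ≥0∞}
    (hX : ∀ i, Measurable (X i)) (hind : iIndepFun X P) {y : ι → ℝ≥0∞}
    (hy : ∀ i, ∫⁻ ω, expNeg (X i ω) ∂P = expNeg (y i)) :
    ∫⁻ ω, expNeg (∑' i, X i ω) ∂P = expNeg (∑' i, y i) := by
  have hsum : ∀ s : Finset ι, ∫⁻ ω, expNeg (∑ i ∈ s, X i ω) ∂P = expNeg (∑ i ∈ s, y i) := by
    intro s
    rw [lintegral_expNeg_sum hX hind, expNeg_sum, Finset.prod_congr rfl fun i _ => hy i]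
  refine tendsto_nhds_unique (tendsto_lintegral_expNeg (l := atTop) (by fun_prop)
    fun ω => (ENNReal.summable (f := fun i => X i ω)).hasSum) ?_
  simp only [hsum]
  exact (continuous_expNeg.tendsto _).comp ENNReal.summable.hasSum

end ExpNeg

section Distributions

/-- The tilt `zⁿ · Poi(m){n} = exp (-m (1 - z)) · Poi(mz){n}` reduces the generating function to
the total mass of a Poisson measure. -/
lemma lintegral_pow_poissonMeasure (m : ℝ≥0) {z : ℝ≥0∞} (hz : z ≤ 1) :
    ∫⁻ n : ℕ, z ^ n ∂(poissonMeasure m) = expNeg (m * (1 - z)) := by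
  lift z to ℝ≥0 using (hz.trans_lt ENNReal.one_lt_top).ne
  have hz' : (z : ℝ) ≤ 1 := by exact_mod_cast hz
  have htilt : ∀ n : ℕ, (z : ℝ≥0∞) ^ n * poissonMeasure m {n} =
      ENNReal.ofReal (Real.exp (-(m * (1 - z)))) * poissonMeasure (m * z) {n} := by
    intro n
    rw [poissonMeasure_singleton, poissonMeasure_singleton, ← ENNReal.ofReal_coe_nnreal,
      ← ENNReal.ofReal_pow (by positivity), ← ENNReal.ofReal_mul (by positivity),
      ← ENNReal.ofReal_mul (by positivity), NNReal.coe_mul, mul_pow]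
    have hexp : Real.exp (-(m * (1 - z))) * Real.exp (-(m * z)) = Real.exp (-m) := by
      rw [← Real.exp_add]; congr 1; ring
    rw [← hexp]
    congr 1; ring
  have hmass : ∑' n : ℕ, poissonMeasure (m * z) {n} = 1 := by
    simpa using (lintegral_countable' (μ := poissonMeasure (m * z)) fun _ => 1).symm
  have hexponent : (m : ℝ≥0∞) * (1 - z) = ENNReal.ofReal (m * (1 - z)) := by
    rw [ENNReal.ofReal_mul (by positivity), ENNReal.ofReal_sub _ (by positivity)]
    simp
  rw [lintegral_countable', tsum_congr htilt, ENNReal.tsum_mul_left, hmass, mul_one, hexponent,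
    expNeg_ofReal (mul_nonneg (by positivity) (sub_nonneg.2 hz'))]

variable {r : ℝ}

lemma measurable_exponentialPDF (r : ℝ) : Measurable (exponentialPDF r) :=
  (measurable_exponentialPDFReal r).ennreal_ofReal

lemma lintegral_expMeasure (r : ℝ) {F : ℝ → ℝ≥0∞} (hF : Measurable F) :
    ∫⁻ x, F x ∂(expMeasure r) = ∫⁻ x, exponentialPDF r x * F x :=
  lintegral_withDensity_eq_lintegral_mul _ (measurable_exponentialPDF r) hF

lemma expMeasure_absolutelyContinuous (r : ℝ) : expMeasure r ≪ volume :=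
  withDensity_absolutelyContinuous _ _

lemma expMeasure_Iic (hr : 0 < r) (x : ℝ) :
    expMeasure r (Set.Iic x) = ENNReal.ofReal (if 0 ≤ x then 1 - Real.exp (-(r * x)) else 0) := by
  have := isProbabilityMeasure_expMeasure hr
  rw [← ofReal_cdf, cdf_expMeasure_eq hr]

lemma ae_pos_expMeasure (hr : 0 < r) : ∀ᵐ x ∂(expMeasure r), 0 < x := by
  rw [ae_iff]
  simp only [not_lt]
  exact (expMeasure_Iic hr 0).trans (by simp)

lemma lintegral_expNeg_expMeasure (hr : 0 < r) (t : ℝ≥0∞) :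
    ∫⁻ x, expNeg (ENNReal.ofReal x * t) ∂(expMeasure r) =
      ENNReal.ofReal r / (ENNReal.ofReal r + t) := by
  induction t with
  | top =>
    rw [add_top, ENNReal.div_top, lintegral_eq_zero_iff (by fun_prop)]
    filter_upwards [ae_pos_expMeasure hr] with x hx
    simp [ENNReal.mul_top, hx]
  | coe t =>
    have hrt : 0 < r + t := by positivity
    have htilt : ∀ x, exponentialPDF r x * expNeg (ENNReal.ofReal x * t) =
        ENNReal.ofReal (r / (r + t)) * exponentialPDF (r + t) x := by
      intro x
      rcases lt_or_ge x 0 with hx | hx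
      · simp [exponentialPDF_of_neg hx]
      · rw [exponentialPDF_of_nonneg hx, exponentialPDF_of_nonneg hx,
          ← ENNReal.ofReal_coe_nnreal, ← ENNReal.ofReal_mul hx, expNeg_ofReal (by positivity),
          ← ENNReal.ofReal_mul (by positivity), ← ENNReal.ofReal_mul (by positivity), mul_assoc,
          ← Real.exp_add, ← mul_assoc, div_mul_cancel₀ _ hrt.ne']
        congr 3; ring
    rw [lintegral_expMeasure r (by fun_prop), lintegral_congr htilt,
      lintegral_const_mul _ (measurable_exponentialPDF _), lintegral_exponentialPDF_eq_one hrt,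
      mul_one, ENNReal.ofReal_div_of_pos hrt, ENNReal.ofReal_add hr.le t.coe_nonneg,
      ENNReal.ofReal_coe_nnreal]

lemma expMeasure_setOf_le_ofReal (hr : 0 < r) (s : ℝ≥0∞) :
    expMeasure r {x | s ≤ ENNReal.ofReal x} = expNeg (ENNReal.ofReal r * s) := by
  have := isProbabilityMeasure_expMeasure hr
  induction s with
  | top => simp [ENNReal.mul_top, hr]
  | coe s =>
    have htail : {x : ℝ | (s : ℝ≥0∞) ≤ ENNReal.ofReal x} =ᵐ[expMeasure r]
        ((Set.Iic (s : ℝ))ᶜ : Set ℝ) := by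
      filter_upwards [ae_pos_expMeasure hr,
        (expMeasure_absolutelyContinuous r).ae_le (Measure.ae_ne volume (s : ℝ))] with x hx hxs
      refine propext ?_
      change (s : ℝ≥0∞) ≤ ENNReal.ofReal x ↔ ¬ x ≤ s
      rw [← ENNReal.ofReal_coe_nnreal, ENNReal.ofReal_le_ofReal_iff hx.le, not_le]
      exact ⟨fun h => lt_of_le_of_ne h hxs.symm, le_of_lt⟩
    have hrs : 0 ≤ r * s := by positivity
    rw [measure_congr htail, prob_compl_eq_one_sub measurableSet_Iic, expMeasure_Iic hr,
      if_pos s.coe_nonneg, ← ENNReal.ofReal_coe_nnreal, ← ENNReal.ofReal_mul hr.le,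
      expNeg_ofReal hrs, ← ENNReal.ofReal_one, ← ENNReal.ofReal_sub _ (by simpa using hrs)]
    simp

lemma lintegral_rpow_expMeasure (hr : 0 < r) {p : ℝ} (hp : -1 < p) :
    ∫⁻ x, ENNReal.ofReal (x ^ p) ∂(expMeasure r) =
      ENNReal.ofReal (r ^ (-p) * Real.Gamma (p + 1)) := by
  have hp' : 0 < p + 1 := by linarith
  have htilt : ∀ x, exponentialPDF r x * ENNReal.ofReal (x ^ p) =
      ENNReal.ofReal (r ^ (-p) * Real.Gamma (p + 1)) * gammaPDF (p + 1) r x := by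
    intro x
    rcases lt_or_ge x 0 with hx | hx
    · simp [exponentialPDF_of_neg hx, gammaPDF_of_neg hx]
    · rw [exponentialPDF_of_nonneg hx, gammaPDF_of_nonneg hx,
        ← ENNReal.ofReal_mul (by positivity), ← ENNReal.ofReal_mul (by positivity),
        Real.rpow_add_one hr.ne', Real.rpow_neg hr.le, add_sub_cancel_right]
      congr 1
      field_simp
  have hpdf : Measurable (gammaPDF (p + 1) r) := (measurable_gammaPDFReal _ _).ennreal_ofReal
  rw [lintegral_expMeasure r (by fun_prop), lintegral_congr htilt, lintegral_const_mul _ hpdf,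
    lintegral_gammaPDF_eq_one hp' hr, mul_one]

end Distributions

section PathLoss

variable {E : Type*} [NormedAddCommGroup E] [NormedSpace ℝ E] [FiniteDimensional ℝ E]
  [MeasurableSpace E] [BorelSpace E] (μ : Measure E) [μ.IsAddHaarMeasure]

lemma lintegral_comp_smul (f : E → ℝ≥0∞) {R : ℝ} (hR : R ≠ 0) :
    ∫⁻ x, f (R • x) ∂μ = ENNReal.ofReal |(R ^ Module.finrank ℝ E)⁻¹| * ∫⁻ x, f x ∂μ := by
  rw [← smul_eq_mul, ← lintegral_smul_measure, ← Measure.map_addHaar_smul μ hR]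
  exact ((Homeomorph.smulOfNeZero R hR).measurableEmbedding.lintegral_map f).symm

lemma lintegral_expNeg_enorm_rpow {α : ℝ} (hα : 0 < α) :
    ∫⁻ x, expNeg (‖x‖ₑ ^ α) ∂μ =
      μ (Metric.ball 0 1) * ENNReal.ofReal (Real.Gamma (Module.finrank ℝ E / α + 1)) := by
  have hΓ : 0 < Real.Gamma (Module.finrank ℝ E / α + 1) := Real.Gamma_pos_of_pos (by positivity)
  have hball := measure_unitBall_eq_integral_div_gamma μ hα
  have hint : Integrable (fun x : E => Real.exp (-‖x‖ ^ α)) μ := by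
    refine Integrable.of_integral_ne_zero fun h => ?_
    rw [h, zero_div, ENNReal.ofReal_zero] at hball
    exact (Metric.measure_ball_pos μ 0 one_pos).ne' hball
  have hexp : ∀ x : E, expNeg (‖x‖ₑ ^ α) = ENNReal.ofReal (Real.exp (-‖x‖ ^ α)) := fun x => by
    rw [← ofReal_norm, ENNReal.ofReal_rpow_of_nonneg (norm_nonneg x) hα.le,
      expNeg_ofReal (by positivity)]
  rw [lintegral_congr hexp, ← ofReal_integral_eq_lintegral_ofReal hint
    (Eventually.of_forall fun x => (Real.exp_pos _).le), hball,
    ← ENNReal.ofReal_mul' hΓ.le, div_mul_cancel₀ _ hΓ.ne']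

lemma lintegral_expNeg_mul_enorm_rpow {α y : ℝ} (hα : 0 < α) (hy : 0 < y) :
    ∫⁻ x, expNeg (ENNReal.ofReal y * ‖x‖ₑ ^ α) ∂μ =
      μ (Metric.ball 0 1) * ENNReal.ofReal (Real.Gamma (Module.finrank ℝ E / α + 1)) *
        ENNReal.ofReal (y ^ (-(Module.finrank ℝ E / α))) := by
  have hR : 0 < y ^ α⁻¹ := by positivity
  have hscale : ∀ x : E, ENNReal.ofReal y * ‖x‖ₑ ^ α = ‖y ^ α⁻¹ • x‖ₑ ^ α := fun x => by
    rw [enorm_smul, ENNReal.mul_rpow_of_nonneg _ _ hα.le, Real.enorm_eq_ofReal hR.le,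
      ENNReal.ofReal_rpow_of_pos hR, Real.rpow_inv_rpow hy.le hα.ne']
  have hfactor : |((y ^ α⁻¹) ^ Module.finrank ℝ E)⁻¹| = y ^ (-(Module.finrank ℝ E / α)) := by
    rw [abs_of_pos (by positivity), ← Real.rpow_natCast, ← Real.rpow_mul hy.le,
      ← Real.rpow_neg hy.le]
    congr 1; ring
  simp only [hscale]
  rw [lintegral_comp_smul μ (fun x => expNeg (‖x‖ₑ ^ α)) hR.ne', lintegral_expNeg_enorm_rpow μ hα,
    hfactor, mul_comm]

lemma one_sub_inv_one_add_mul_inv {s : ℝ≥0∞} (hs : s ≠ 0) (hs' : s ≠ ∞) (D : ℝ≥0∞) :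
    1 - (1 + s * D⁻¹)⁻¹ = s / (s + D) := by
  rcases eq_or_ne D 0 with rfl | hD
  · simp [ENNReal.mul_top hs, ENNReal.div_self hs hs']
  rcases eq_or_ne D ∞ with rfl | hD'
  · simp
  have hsD : s + D ≠ 0 := by simp [hs]
  have hsD' : s + D ≠ ∞ := by simp [hs', hD']
  have hinv : (1 + s * D⁻¹)⁻¹ = D / (s + D) := by
    rw [← ENNReal.inv_div (.inl hD') (.inl hD), ENNReal.add_div, ENNReal.div_self hD hD', add_comm,
      div_eq_mul_inv]
  rw [hinv]
  refine ENNReal.sub_eq_of_eq_add (ENNReal.div_ne_top hD' hsD) ?_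
  rw [← ENNReal.add_div, ENNReal.div_self hsD hsD']

/-- `s / (s + D)` is the Laplace transform at `D` of the exponential distribution of rate `s`,
which reduces the integral to a Gaussian-type one over the space and a moment of that law. -/
lemma lintegral_one_sub_inv_one_add_mul_edist_rpow {α s : ℝ} (hα : Module.finrank ℝ E < α)
    (hs : 0 < s) (b : E) :
    ∫⁻ x, (1 - (1 + ENNReal.ofReal s * edist x b ^ (-α))⁻¹) ∂μ =
      μ (Metric.ball 0 1) * ENNReal.ofReal (Real.Gamma (Module.finrank ℝ E / α + 1)) *
        ENNReal.ofReal (s ^ (Module.finrank ℝ E / α) *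
          Real.Gamma (1 - Module.finrank ℝ E / α)) := by
  have hα0 : 0 < α := (Nat.cast_nonneg _).trans_lt hα
  have hδ : -1 < -(Module.finrank ℝ E / α) := by
    rw [neg_lt_neg_iff, div_lt_one hα0]; exact hα
  have := isProbabilityMeasure_expMeasure hs
  have hlaplace : ∀ x : E, 1 - (1 + ENNReal.ofReal s * ‖x‖ₑ ^ (-α))⁻¹ =
      ∫⁻ y, expNeg (ENNReal.ofReal y * ‖x‖ₑ ^ α) ∂(expMeasure s) := fun x => by
    rw [ENNReal.rpow_neg, one_sub_inv_one_add_mul_inv (by simpa using hs) ENNReal.ofReal_ne_top,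
      lintegral_expNeg_expMeasure hs]
  have hspace : ∀ᵐ y ∂(expMeasure s), ∫⁻ x, expNeg (ENNReal.ofReal y * ‖x‖ₑ ^ α) ∂μ =
      μ (Metric.ball 0 1) * ENNReal.ofReal (Real.Gamma (Module.finrank ℝ E / α + 1)) *
        ENNReal.ofReal (y ^ (-(Module.finrank ℝ E / α))) := by
    filter_upwards [ae_pos_expMeasure hs] with y hy using lintegral_expNeg_mul_enorm_rpow μ hα0 hy
  simp only [edist_eq_enorm_sub]
  rw [lintegral_sub_right_eq_self
      (fun x => 1 - (1 + ENNReal.ofReal s * ‖x‖ₑ ^ (-α))⁻¹) b, lintegral_congr hlaplace,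
    lintegral_lintegral_swap (by fun_prop), lintegral_congr_ae hspace,
    lintegral_const_mul _ (by fun_prop), lintegral_rpow_expMeasure hs hδ, neg_neg, neg_add_eq_sub]

lemma Gamma_add_one_mul_Gamma_one_sub {δ : ℝ} (hδ : δ ≠ 0) :
    Real.Gamma (δ + 1) * Real.Gamma (1 - δ) = Real.pi * δ / Real.sin (Real.pi * δ) := by
  rw [Real.Gamma_add_one hδ, mul_assoc, Real.Gamma_mul_Gamma_one_sub]
  ring

/-- The exponent, per unit density of transmitters in the plane, of the Laplace transform at `s` of
the interference under the path loss `d ^ (-α)`. -/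
noncomputable def interferenceExponent (α s : ℝ) : ℝ :=
  Real.pi * s ^ (2 / α) * ((2 * Real.pi / α) / Real.sin (2 * Real.pi / α))

variable {α : ℝ}

lemma sin_two_pi_div_pos (hα : 2 < α) : 0 < Real.sin (2 * Real.pi / α) := by
  have hα0 : 0 < α := by linarith
  refine Real.sin_pos_of_pos_of_lt_pi (by positivity) ?_
  rw [div_lt_iff₀ hα0]
  nlinarith [Real.pi_pos]

lemma interferenceExponent_nonneg (hα : 2 < α) {s : ℝ} (hs : 0 ≤ s) :
    0 ≤ interferenceExponent α s := by
  have := sin_two_pi_div_pos hα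
  have := Real.pi_pos
  unfold interferenceExponent
  positivity

lemma lintegral_one_sub_inv_one_add_mul_edist_rpow_plane (hα : 2 < α) {s : ℝ} (hs : 0 ≤ s)
    (b : Plane) :
    ∫⁻ x : Plane, (1 - (1 + ENNReal.ofReal s * edist x b ^ (-α))⁻¹) =
      ENNReal.ofReal (interferenceExponent α s) := by
  have hδ : 2 / α ≠ 0 := by positivity
  rcases hs.eq_or_lt with rfl | hs
  · simp [interferenceExponent, Real.zero_rpow hδ]
  · have hball : volume (Metric.ball (0 : Plane) 1) = ENNReal.ofReal Real.pi := by
      simp [EuclideanSpace.volume_ball_fin_two]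
    have hangle : Real.pi * (2 / α) = 2 * Real.pi / α := by ring
    rw [lintegral_one_sub_inv_one_add_mul_edist_rpow volume (by simpa using hα) hs b, hball,
      finrank_euclideanSpace_fin, Nat.cast_ofNat, ← ENNReal.ofReal_mul Real.pi_nonneg,
      ← ENNReal.ofReal_mul (by positivity), interferenceExponent]
    congr 1
    calc Real.pi * Real.Gamma (2 / α + 1) * (s ^ (2 / α) * Real.Gamma (1 - 2 / α))
        = Real.pi * s ^ (2 / α) * (Real.Gamma (2 / α + 1) * Real.Gamma (1 - 2 / α)) := by ring
      _ = Real.pi * s ^ (2 / α) * ((2 * Real.pi / α) / Real.sin (2 * Real.pi / α)) := by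
        rw [Gamma_add_one_mul_Gamma_one_sub hδ, hangle]

end PathLoss

section PolarCoordinates

/-- The volume preserving identification of the plane with `ℝ × ℝ`, on which polar coordinates
are defined. -/
noncomputable def planeEquivProd : Plane ≃ᵐ ℝ × ℝ :=
  (MeasurableEquiv.toLp 2 (Fin 2 → ℝ)).symm.trans MeasurableEquiv.finTwoArrow

lemma measurePreserving_planeEquivProd_symm : MeasurePreserving planeEquivProd.symm :=
  ((volume_preserving_finTwoArrow ℝ).comp
    (EuclideanSpace.volume_preserving_symm_measurableEquiv_toLp (Fin 2))).symm planeEquivProd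

lemma dist_polarPoint_sq (r θ r' θ' : ℝ) :
    dist (polarPoint r θ) (polarPoint r' θ') ^ 2 = cosineDistSq r θ r' θ' := by
  rw [EuclideanSpace.dist_eq, Real.sq_sqrt (by positivity)]
  simp only [polarPoint, cosineDistSq, Fin.sum_univ_two, Real.dist_eq, sq_abs, Real.cos_sub,
    Matrix.cons_val_zero, Matrix.cons_val_one]
  linear_combination r ^ 2 * Real.sin_sq_add_cos_sq θ + r' ^ 2 * Real.sin_sq_add_cos_sq θ'

lemma continuous_polarPoint : Continuous fun q : ℝ × ℝ => polarPoint q.1 q.2 := by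
  unfold polarPoint
  fun_prop

lemma measurableSet_polarRegion {A : Set Plane} (hA : MeasurableSet A) :
    MeasurableSet (polarRegion A) :=
  (measurable_fst measurableSet_Ioi).inter ((measurable_snd measurableSet_Ioc).inter
    (continuous_polarPoint.measurable hA))

lemma polarCoord_target_inter_ae_eq_polarRegion (A : Set Plane) :
    (polarCoord.target ∩ {q | polarPoint q.1 q.2 ∈ A} : Set (ℝ × ℝ)) =ᵐ[volume] polarRegion A := by
  have hangle : ∀ᵐ q : ℝ × ℝ, q.2 ≠ Real.pi := by
    rw [Measure.volume_eq_prod]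
    exact Measure.quasiMeasurePreserving_snd.ae (Measure.ae_ne volume Real.pi)
  filter_upwards [hangle] with q hq
  have hle : q.2 ≤ Real.pi ↔ q.2 < Real.pi := ⟨fun h => h.lt_of_ne hq, le_of_lt⟩
  refine propext ?_
  change (0 < q.1 ∧ -Real.pi < q.2 ∧ q.2 < Real.pi) ∧ polarPoint q.1 q.2 ∈ A ↔
    0 < q.1 ∧ (-Real.pi < q.2 ∧ q.2 ≤ Real.pi) ∧ polarPoint q.1 q.2 ∈ A
  rw [hle, and_assoc]

lemma setLIntegral_eq_polarRegion {A : Set Plane} (hA : MeasurableSet A) (F : Plane → ℝ≥0∞) :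
    ∫⁻ x in A, F x = ∫⁻ q in polarRegion A, ENNReal.ofReal q.1 * F (polarPoint q.1 q.2) := by
  have hpre : MeasurableSet {q : ℝ × ℝ | polarPoint q.1 q.2 ∈ A} :=
    continuous_polarPoint.measurable hA
  calc ∫⁻ x in A, F x = ∫⁻ x, A.indicator F x := (lintegral_indicator hA F).symm
    _ = ∫⁻ z : ℝ × ℝ, A.indicator F (planeEquivProd.symm z) :=
      (measurePreserving_planeEquivProd_symm.lintegral_comp_emb
        planeEquivProd.symm.measurableEmbedding _).symm
    _ = ∫⁻ q in polarCoord.target, ENNReal.ofReal q.1 • A.indicator F (polarPoint q.1 q.2) :=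
      (lintegral_comp_polarCoord_symm fun z => A.indicator F (planeEquivProd.symm z)).symm
    _ = ∫⁻ q in polarCoord.target, {q : ℝ × ℝ | polarPoint q.1 q.2 ∈ A}.indicator
          (fun q => ENNReal.ofReal q.1 * F (polarPoint q.1 q.2)) q := by
      refine lintegral_congr fun q => ?_
      by_cases hq : polarPoint q.1 q.2 ∈ A <;> simp [hq]
    _ = ∫⁻ q in {q : ℝ × ℝ | polarPoint q.1 q.2 ∈ A} ∩ polarCoord.target,
          ENNReal.ofReal q.1 * F (polarPoint q.1 q.2) := setLIntegral_indicator hpre _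
    _ = ∫⁻ q in polarRegion A, ENNReal.ofReal q.1 * F (polarPoint q.1 q.2) := by
      rw [Set.inter_comm]
      exact setLIntegral_congr (polarCoord_target_inter_ae_eq_polarRegion A)

end PolarCoordinates

section PointProcesses

lemma measurable_tsum_lt {E : Type*} [MeasurableSpace E] {φ : E → ℕ → ℝ≥0∞} {n : E → ℕ∞}
    (hφ : ∀ j, Measurable fun e => φ e j) (hn : Measurable n) :
    Measurable fun e => ∑' j : {j : ℕ // (j : ℕ∞) < n e}, φ e j := by
  have htsum : ∀ e, ∑' j : {j : ℕ // (j : ℕ∞) < n e}, φ e j =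
      ∑' j : ℕ, {e | (j : ℕ∞) < n e}.indicator (fun e => φ e j) e := fun e =>
    (tsum_subtype {j : ℕ | (j : ℕ∞) < n e} (φ e)).trans
      (tsum_congr fun j => by simp [Set.indicator])
  simp only [htsum]
  exact Measurable.tsum fun j => (hφ j).indicator (hn (.of_discrete (s := Set.Ioi (j : ℕ∞))))

/-- The counting measure of a sequence of points, with multiplicities: integrating against it
sums over the points. -/
noncomputable def PointSeq.toMeasure (c : PointSeq) : Measure Plane :=
  Measure.sum fun j : {j : ℕ // (j : ℕ∞) < c.1} => Measure.dirac (c.2 j)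

lemma PointSeq.lintegral_toMeasure (c : PointSeq) (φ : Plane → ℝ≥0∞) :
    ∫⁻ x, φ x ∂c.toMeasure = ∑' j : {j : ℕ // (j : ℕ∞) < c.1}, φ (c.2 j) := by
  simp [PointSeq.toMeasure, lintegral_sum_measure]

lemma PointSeq.toMeasure_apply (c : PointSeq) {A : Set Plane} (hA : MeasurableSet A) :
    c.toMeasure A = (c.count A : ℝ≥0∞) := by
  have hmem : ∀ j : {j : ℕ // (j : ℕ∞) < c.1}, Measure.dirac (c.2 j) A =
      {j : ℕ | c.2 j ∈ A}.indicator 1 (j : ℕ) := fun j => by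
    rw [Measure.dirac_apply' _ hA]
    rfl
  rw [PointSeq.toMeasure, Measure.sum_apply _ hA, tsum_congr hmem, PointSeq.count,
    ← ENNReal.tsum_set_one, tsum_subtype {j : ℕ | (j : ℕ∞) < c.1 ∧ c.2 j ∈ A} fun _ => 1]
  refine (tsum_subtype {j : ℕ | (j : ℕ∞) < c.1} _).trans ?_
  rw [Set.indicator_indicator]
  rfl

lemma PointSeq.measurable_lintegral_toMeasure {φ : Plane → ℝ≥0∞} (hφ : Measurable φ) :
    Measurable fun c : PointSeq => ∫⁻ x, φ x ∂c.toMeasure := by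
  simp only [PointSeq.lintegral_toMeasure]
  exact measurable_tsum_lt (φ := fun (c : PointSeq) j => φ (c.2 j)) (by fun_prop) measurable_fst

lemma PointSeq.measurable_count {A : Set Plane} (hA : MeasurableSet A) :
    Measurable fun c : PointSeq => (c.count A : ℝ≥0∞) := by
  simp only [← PointSeq.toMeasure_apply _ hA, ← lintegral_indicator_one hA]
  exact PointSeq.measurable_lintegral_toMeasure (measurable_one.indicator hA)

lemma lintegral_comp_simpleFunc {X β : Type*} [MeasurableSpace X] [Zero β] [DecidableEq β]
    (μ : Measure X) (φ : SimpleFunc X β) {g : β → ℝ≥0∞} (hg : g 0 = 0) :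
    ∫⁻ x, g (φ x) ∂μ = ∑ y : φ.range.filter (· ≠ 0), g y * μ (φ ⁻¹' {(y : β)}) := by
  rw [Finset.sum_coe_sort (φ.range.filter (· ≠ 0)) fun y => g y * μ (φ ⁻¹' {y}),
    Finset.sum_filter_of_ne]
  · rw [← SimpleFunc.map_lintegral]
    exact (φ.map g).lintegral_eq_lintegral μ
  · rintro y - hy rfl
    simp [hg] at hy

lemma exists_simpleFunc_isBounded_support_tendsto {E : Type*} [SeminormedAddCommGroup E]
    [MeasurableSpace E] [OpensMeasurableSpace E] {φ : E → ℝ≥0∞} (hφ : Measurable φ) :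
    ∃ ψ : ℕ → SimpleFunc E ℝ≥0∞, (∀ n, Bornology.IsBounded (Function.support (ψ n))) ∧
      (∀ x, Monotone fun n => ψ n x) ∧ ∀ x, Tendsto (fun n => ψ n x) atTop (𝓝 (φ x)) := by
  refine ⟨fun n => (SimpleFunc.eapprox φ n).restrict (Metric.ball 0 n),
    fun n => ?_, fun x m n hmn => ?_, fun x => ?_⟩
  · rw [SimpleFunc.coe_restrict _ measurableSet_ball]
    exact Metric.isBounded_ball.subset Set.support_indicator_subset
  · simp only [SimpleFunc.restrict_apply _ measurableSet_ball]
    exact (Set.indicator_le_indicator (SimpleFunc.monotone_eapprox φ hmn x)).trans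
      (Set.indicator_le_indicator_of_subset
        (Metric.ball_subset_ball (by exact_mod_cast hmn)) (fun _ => zero_le) x)
  · refine (SimpleFunc.tendsto_eapprox hφ x).congr' ?_
    obtain ⟨N, hN⟩ := exists_nat_gt ‖x‖
    filter_upwards [eventually_ge_atTop N] with n hn
    rw [SimpleFunc.restrict_apply _ measurableSet_ball, Set.indicator_of_mem]
    exact mem_ball_zero_iff.2 (hN.trans_le (by exact_mod_cast hn))

namespace IsHPPP

variable {Ω : Type*} [MeasurableSpace Ω] {P : Measure Ω} {lam : ℝ≥0} {Φ : Ω → PointSeq}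

lemma iIndepFun_count_of_finite (hΦ : IsHPPP lam Φ P) {ι : Type*} [Finite ι] {A : ι → Set Plane}
    (hA : ∀ i, MeasurableSet (A i)) (hAb : ∀ i, Bornology.IsBounded (A i))
    (hAd : Pairwise fun i j => Disjoint (A i) (A j)) :
    iIndepFun (fun i ω => (Φ ω).count (A i)) P := by
  obtain ⟨k, ⟨e⟩⟩ := Finite.exists_equiv_fin ι
  exact iIndepFun.of_precomp e.symm.surjective (hΦ.iIndepFun_count k (A ∘ e.symm)
    (fun i => hA _) (fun i => hAb _) fun i j hij => hAd (e.symm.injective.ne hij))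

lemma lintegral_expNeg_mul_count (hΦ : IsHPPP lam Φ P) {A : Set Plane} (hA : MeasurableSet A)
    (hAb : Bornology.IsBounded A) (y : ℝ≥0∞) :
    ∫⁻ ω, expNeg (y * (Φ ω).count A) ∂P = expNeg (lam * ((1 - expNeg y) * volume A)) := by
  have hm : Measurable fun n : ℕ∞ => expNeg (y * (n : ℝ≥0∞)) := measurable_from_top
  rw [(hΦ.hasLaw_count A hA hAb).lintegral_comp hm.aemeasurable,
    lintegral_map hm measurable_from_top]
  simp only [ENat.toENNReal_coe, expNeg_mul_natCast]
  rw [lintegral_pow_poissonMeasure _ (expNeg_le_one y), ENNReal.coe_mul,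
    ENNReal.coe_toNNReal hAb.measure_lt_top.ne, mul_assoc, mul_comm (volume A)]

lemma lintegral_expNeg_sum_mul_count (hΦ : IsHPPP lam Φ P) {ι : Type*} [Fintype ι]
    {A : ι → Set Plane} (hA : ∀ i, MeasurableSet (A i)) (hAb : ∀ i, Bornology.IsBounded (A i))
    (hAd : Pairwise fun i j => Disjoint (A i) (A j)) (y : ι → ℝ≥0∞) :
    ∫⁻ ω, expNeg (∑ i, y i * (Φ ω).count (A i)) ∂P =
      expNeg (lam * ∑ i, (1 - expNeg (y i)) * volume (A i)) := by
  have hX : ∀ i, Measurable fun ω => y i * ((Φ ω).count (A i) : ℝ≥0∞) := fun i =>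
    ((PointSeq.measurable_count (hA i)).comp hΦ.measurable).const_mul _
  have hind : iIndepFun (fun i ω => y i * ((Φ ω).count (A i) : ℝ≥0∞)) P :=
    (hΦ.iIndepFun_count_of_finite hA hAb hAd).comp (fun i (n : ℕ∞) => y i * (n : ℝ≥0∞))
      fun i => measurable_from_top
  rw [lintegral_expNeg_sum hX hind,
    Finset.prod_congr rfl fun i _ => hΦ.lintegral_expNeg_mul_count (hA i) (hAb i) (y i),
    ← expNeg_sum, ← Finset.mul_sum]

lemma lintegral_expNeg_simpleFunc (hΦ : IsHPPP lam Φ P) (φ : SimpleFunc Plane ℝ≥0∞)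
    (hφ : Bornology.IsBounded (Function.support φ)) :
    ∫⁻ ω, expNeg (∫⁻ x, φ x ∂(Φ ω).toMeasure) ∂P = expNeg (lam * ∫⁻ x, (1 - expNeg (φ x))) := by
  classical
  have hfiber : ∀ y : φ.range.filter (· ≠ 0), Bornology.IsBounded (φ ⁻¹' {(y : ℝ≥0∞)}) :=
    fun y => hφ.subset fun x hx => by
      rw [Function.mem_support, show φ x = y from hx]
      exact (Finset.mem_filter.1 y.2).2
  have hdisj : Pairwise fun y z : φ.range.filter (· ≠ 0) =>
      Disjoint (φ ⁻¹' {(y : ℝ≥0∞)}) (φ ⁻¹' {(z : ℝ≥0∞)}) := fun y z hyz =>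
    Disjoint.preimage _ (Set.disjoint_singleton.2 (Subtype.coe_injective.ne hyz))
  have hcount : ∀ ω, ∫⁻ x, φ x ∂(Φ ω).toMeasure =
      ∑ y : φ.range.filter (· ≠ 0), (y : ℝ≥0∞) * (Φ ω).count (φ ⁻¹' {(y : ℝ≥0∞)}) := fun ω =>
    (lintegral_comp_simpleFunc (Φ ω).toMeasure φ (g := id) rfl).trans
      (Finset.sum_congr rfl fun y _ => by
        rw [PointSeq.toMeasure_apply _ (φ.measurableSet_fiber _), id])
  simp only [hcount]
  rw [hΦ.lintegral_expNeg_sum_mul_count (fun _ => φ.measurableSet_fiber _) hfiber hdisj,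
    lintegral_comp_simpleFunc volume φ (g := fun y => 1 - expNeg y) (by simp)]

lemma lintegral_expNeg [IsFiniteMeasure P] (hΦ : IsHPPP lam Φ P) {φ : Plane → ℝ≥0∞}
    (hφ : Measurable φ) :
    ∫⁻ ω, expNeg (∫⁻ x, φ x ∂(Φ ω).toMeasure) ∂P = expNeg (lam * ∫⁻ x, (1 - expNeg (φ x))) := by
  obtain ⟨ψ, hbdd, hmono, hlim⟩ := exists_simpleFunc_isBounded_support_tendsto hφ
  have hleft : Tendsto (fun n => ∫⁻ ω, expNeg (∫⁻ x, ψ n x ∂(Φ ω).toMeasure) ∂P) atTop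
      (𝓝 (∫⁻ ω, expNeg (∫⁻ x, φ x ∂(Φ ω).toMeasure) ∂P)) :=
    tendsto_lintegral_expNeg
      (fun n => (PointSeq.measurable_lintegral_toMeasure (ψ n).measurable).comp hΦ.measurable)
      fun ω => lintegral_tendsto_of_tendsto_of_monotone (fun n => (ψ n).measurable.aemeasurable)
        (Eventually.of_forall hmono) (Eventually.of_forall hlim)
  have hright : Tendsto (fun n => ∫⁻ x, (1 - expNeg (ψ n x))) atTop
      (𝓝 (∫⁻ x, (1 - expNeg (φ x)))) :=
    lintegral_tendsto_of_tendsto_of_monotone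
      (fun n => (measurable_const.sub (measurable_expNeg.comp (ψ n).measurable)).aemeasurable)
      (Eventually.of_forall fun x m n hmn => tsub_le_tsub_left (antitone_expNeg (hmono x hmn)) 1)
      (Eventually.of_forall fun x => ENNReal.Tendsto.sub tendsto_const_nhds
        ((continuous_expNeg.tendsto _).comp (hlim x)) (.inl ENNReal.one_ne_top))
  simp only [fun n => hΦ.lintegral_expNeg_simpleFunc (ψ n) (hbdd n)] at hleft
  exact tendsto_nhds_unique hleft ((continuous_expNeg.tendsto _).comp
    (ENNReal.Tendsto.const_mul hright (.inr ENNReal.coe_ne_top)))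

end IsHPPP

end PointProcesses

section Independence

lemma measurable_biSup_of_mem {Ω ι β : Type*} [MeasurableSpace β] {m : ι → MeasurableSpace Ω}
    {S : Set ι} {i : ι} (hi : i ∈ S) {X : Ω → β} (hX : Measurable[m i] X) :
    Measurable[⨆ i ∈ S, m i] X :=
  hX.mono (le_iSup₂ (f := fun i (_ : i ∈ S) => m i) i hi) le_rfl

variable {Ω β γ : Type*} [MeasurableSpace Ω] [MeasurableSpace β] [MeasurableSpace γ]
  {P : Measure Ω}

lemma lintegral_comp_prodMk_of_indepFun [IsFiniteMeasure P] {X : Ω → β} {Y : Ω → γ}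
    (hX : Measurable X) (hY : Measurable Y) (hXY : IndepFun X Y P) {F : β × γ → ℝ≥0∞}
    (hF : Measurable F) :
    ∫⁻ ω, F (X ω, Y ω) ∂P = ∫⁻ x, ∫⁻ ω, F (x, Y ω) ∂P ∂(P.map X) := by
  rw [← lintegral_map hF (hX.prodMk hY),
    (indepFun_iff_map_prod_eq_prod_map_map hX.aemeasurable hY.aemeasurable).1 hXY,
    lintegral_prod _ hF.aemeasurable]
  exact lintegral_congr fun x => lintegral_map (hF.comp measurable_prodMk_left) hY

lemma measure_le_ofReal_of_indepFun [IsFiniteMeasure P] {r : ℝ} (hr : 0 < r) {S : Ω → ℝ≥0∞}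
    (hS : Measurable S) {X : Ω → ℝ} (hX : Measurable X) (hlaw : HasLaw X (expMeasure r) P)
    (hSX : IndepFun S X P) :
    P {ω | S ω ≤ ENNReal.ofReal (X ω)} = ∫⁻ ω, expNeg (ENNReal.ofReal r * S ω) ∂P := by
  have hT : MeasurableSet {p : ℝ≥0∞ × ℝ | p.1 ≤ ENNReal.ofReal p.2} :=
    measurableSet_le measurable_fst (by fun_prop)
  have htail : ∀ s : ℝ≥0∞, ∫⁻ ω, {p : ℝ≥0∞ × ℝ | p.1 ≤ ENNReal.ofReal p.2}.indicator 1 (s, X ω) ∂P =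
      expNeg (ENNReal.ofReal r * s) := fun s => by
    have hTs : MeasurableSet {x : ℝ | s ≤ ENNReal.ofReal x} := measurable_prodMk_left hT
    rw [← expMeasure_setOf_le_ofReal hr, ← hlaw.map_eq, Measure.map_apply hX hTs]
    exact lintegral_indicator_one (hX hTs)
  calc P {ω | S ω ≤ ENNReal.ofReal (X ω)}
      = ∫⁻ ω, {p : ℝ≥0∞ × ℝ | p.1 ≤ ENNReal.ofReal p.2}.indicator 1 (S ω, X ω) ∂P :=
        (lintegral_indicator_one ((hS.prodMk hX) hT)).symm
    _ = ∫⁻ s, expNeg (ENNReal.ofReal r * s) ∂(P.map S) := by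
        rw [lintegral_comp_prodMk_of_indepFun hS hX hSX (measurable_one.indicator hT),
          lintegral_congr htail]
    _ = ∫⁻ ω, expNeg (ENNReal.ofReal r * S ω) ∂P := lintegral_map (by fun_prop) hS

lemma indepFun_of_iIndep {ι : Type*} {m : ι → MeasurableSpace Ω} (hm : iIndep m P)
    (hle : ∀ i, m i ≤ ‹MeasurableSpace Ω›) {S T : Set ι} (hST : Disjoint S T) {X : Ω → β}
    {Y : Ω → γ} (hX : Measurable[⨆ i ∈ S, m i] X) (hY : Measurable[⨆ i ∈ T, m i] Y) :
    IndepFun X Y P :=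
  indep_of_indep_of_le_left (indep_of_indep_of_le_right (indep_iSup_of_disjoint hle hm hST)
    (measurable_iff_comap_le.1 hY)) (measurable_iff_comap_le.1 hX)

lemma indepFun_prodMk_of_iIndep_six {β₀ β₁ β₂ β₃ β₄ β₅ : Type*} [MeasurableSpace β₀]
    [MeasurableSpace β₁] [MeasurableSpace β₂] [MeasurableSpace β₃] [MeasurableSpace β₄]
    [MeasurableSpace β₅] {X₀ : Ω → β₀} {X₁ : Ω → β₁} {X₂ : Ω → β₂} {X₃ : Ω → β₃} {X₄ : Ω → β₄}
    {X₅ : Ω → β₅} (h₀ : Measurable X₀) (h₁ : Measurable X₁) (h₂ : Measurable X₂)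
    (h₃ : Measurable X₃) (h₄ : Measurable X₄) (h₅ : Measurable X₅)
    (hindep : iIndep ![MeasurableSpace.comap X₀ inferInstance,
      MeasurableSpace.comap X₁ inferInstance, MeasurableSpace.comap X₂ inferInstance,
      MeasurableSpace.comap X₃ inferInstance, MeasurableSpace.comap X₄ inferInstance,
      MeasurableSpace.comap X₅ inferInstance] P) :
    IndepFun (fun ω => (X₀ ω, (X₂ ω, X₃ ω), X₄ ω, X₅ ω)) X₁ P ∧
      IndepFun X₀ (fun ω => ((X₂ ω, X₃ ω), X₄ ω, X₅ ω)) P ∧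
      IndepFun (fun ω => (X₂ ω, X₃ ω)) (fun ω => (X₄ ω, X₅ ω)) P ∧
      IndepFun X₂ X₃ P ∧ IndepFun X₄ X₅ P := by
  set m := ![MeasurableSpace.comap X₀ inferInstance, MeasurableSpace.comap X₁ inferInstance,
    MeasurableSpace.comap X₂ inferInstance, MeasurableSpace.comap X₃ inferInstance,
    MeasurableSpace.comap X₄ inferInstance, MeasurableSpace.comap X₅ inferInstance]
  have hle : ∀ i, m i ≤ ‹MeasurableSpace Ω› := by
    intro i
    fin_cases i
    exacts [h₀.comap_le, h₁.comap_le, h₂.comap_le, h₃.comap_le, h₄.comap_le, h₅.comap_le]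
  have m₀ {S : Set (Fin 6)} (h : 0 ∈ S) := measurable_biSup_of_mem (m := m) h (comap_measurable X₀)
  have m₁ {S : Set (Fin 6)} (h : 1 ∈ S) := measurable_biSup_of_mem (m := m) h (comap_measurable X₁)
  have m₂ {S : Set (Fin 6)} (h : 2 ∈ S) := measurable_biSup_of_mem (m := m) h (comap_measurable X₂)
  have m₃ {S : Set (Fin 6)} (h : 3 ∈ S) := measurable_biSup_of_mem (m := m) h (comap_measurable X₃)
  have m₄ {S : Set (Fin 6)} (h : 4 ∈ S) := measurable_biSup_of_mem (m := m) h (comap_measurable X₄)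
  have m₅ {S : Set (Fin 6)} (h : 5 ∈ S) := measurable_biSup_of_mem (m := m) h (comap_measurable X₅)
  refine ⟨indepFun_of_iIndep hindep hle (S := {0, 2, 3, 4, 5}) (T := {1}) (by simp) ?_ ?_,
    indepFun_of_iIndep hindep hle (S := {0}) (T := {2, 3, 4, 5}) (by simp) ?_ ?_,
    indepFun_of_iIndep hindep hle (S := {2, 3}) (T := {4, 5}) (by simp) ?_ ?_,
    indepFun_of_iIndep hindep hle (S := {2}) (T := {3}) (by simp) ?_ ?_,
    indepFun_of_iIndep hindep hle (S := {4}) (T := {5}) (by simp) ?_ ?_⟩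
  exacts [(m₀ (by simp)).prodMk (((m₂ (by simp)).prodMk (m₃ (by simp))).prodMk
      ((m₄ (by simp)).prodMk (m₅ (by simp)))), m₁ (by simp),
    m₀ (by simp), ((m₂ (by simp)).prodMk (m₃ (by simp))).prodMk
      ((m₄ (by simp)).prodMk (m₅ (by simp))),
    (m₂ (by simp)).prodMk (m₃ (by simp)), (m₄ (by simp)).prodMk (m₅ (by simp)),
    m₂ (by simp), m₃ (by simp), m₄ (by simp), m₅ (by simp)]

end Independence

section Interference

variable {Ω : Type*} [MeasurableSpace Ω] {P : Measure Ω} {α : ℝ}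

@[fun_prop]
lemma measurable_receivedPower (α : ℝ) (b : Plane) :
    Measurable fun p : PointSeq × (ℕ → ℝ) => receivedPower α b p.1 p.2 :=
  measurable_tsum_lt (φ := fun (p : PointSeq × (ℕ → ℝ)) j =>
    ENNReal.ofReal (p.2 j) * edist (p.1.2 j) b ^ (-α)) (by fun_prop) (by fun_prop)

lemma IsExpFading.lintegral_expNeg_receivedPower [IsFiniteMeasure P] {f : Ω → ℕ → ℝ}
    (hf : IsExpFading f P) (α : ℝ) (b : Plane) (t : ℝ≥0∞) (c : PointSeq) :
    ∫⁻ ω, expNeg (t * receivedPower α b c (f ω)) ∂P =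
      expNeg (∫⁻ x, logOneAdd (t * edist x b ^ (-α)) ∂c.toMeasure) := by
  have hg : ∀ y : ℝ≥0∞, Measurable fun x : ℝ => t * (ENNReal.ofReal x * y) := by fun_prop
  have hfm : ∀ j, Measurable fun ω => f ω j := fun j => measurable_pi_iff.1 hf.measurable j
  have hlaplace : ∀ (j : ℕ) (y : ℝ≥0∞),
      ∫⁻ ω, expNeg (t * (ENNReal.ofReal (f ω j) * y)) ∂P = expNeg (logOneAdd (t * y)) := by
    intro j y
    rw [(hf.hasLaw j).lintegral_comp (f := fun x => expNeg (t * (ENNReal.ofReal x * y)))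
      (by fun_prop)]
    simp only [mul_left_comm t]
    rw [lintegral_expNeg_expMeasure one_pos, expNeg_logOneAdd, ENNReal.ofReal_one, one_div]
  have hind : ProbabilityTheory.iIndepFun (fun (j : {j : ℕ // (j : ℕ∞) < c.1}) ω =>
      t * (ENNReal.ofReal (f ω j) * edist (c.2 j) b ^ (-α))) P :=
    (hf.iIndepFun.precomp Subtype.val_injective).comp _ fun _ => hg _
  simp only [receivedPower, ← ENNReal.tsum_mul_left, PointSeq.lintegral_toMeasure]
  refine lintegral_expNeg_tsum ?_ hind fun j => hlaplace j _
  exact fun j => (hg _).comp (hfm j)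

variable {lam lamI : ℝ≥0} {Φ ΦI : Ω → PointSeq} {f g : Ω → ℕ → ℝ}

lemma lintegral_expNeg_receivedPower [IsFiniteMeasure P] (hΦ : IsHPPP lam Φ P)
    (hf : IsExpFading f P) (hΦf : IndepFun Φ f P) (hα : 2 < α) {s : ℝ} (hs : 0 ≤ s) (b : Plane) :
    ∫⁻ ω, expNeg (ENNReal.ofReal s * receivedPower α b (Φ ω) (f ω)) ∂P =
      expNeg (ENNReal.ofReal (lam * interferenceExponent α s)) := by
  have hφ : Measurable fun x : Plane => logOneAdd (ENNReal.ofReal s * edist x b ^ (-α)) := by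
    fun_prop
  calc ∫⁻ ω, expNeg (ENNReal.ofReal s * receivedPower α b (Φ ω) (f ω)) ∂P
      = ∫⁻ c, ∫⁻ ω, expNeg (ENNReal.ofReal s * receivedPower α b c (f ω)) ∂P ∂(P.map Φ) :=
        lintegral_comp_prodMk_of_indepFun hΦ.measurable hf.measurable hΦf
          (F := fun p => expNeg (ENNReal.ofReal s * receivedPower α b p.1 p.2)) (by fun_prop)
    _ = ∫⁻ c, expNeg (∫⁻ x, logOneAdd (ENNReal.ofReal s * edist x b ^ (-α)) ∂c.toMeasure)
          ∂(P.map Φ) := by simp only [hf.lintegral_expNeg_receivedPower]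
    _ = ∫⁻ ω, expNeg (∫⁻ x, logOneAdd (ENNReal.ofReal s * edist x b ^ (-α)) ∂(Φ ω).toMeasure) ∂P :=
        lintegral_map (measurable_expNeg.comp (PointSeq.measurable_lintegral_toMeasure hφ))
          hΦ.measurable
    _ = expNeg (lam * ∫⁻ x : Plane, (1 - (1 + ENNReal.ofReal s * edist x b ^ (-α))⁻¹)) := by
        simp only [hΦ.lintegral_expNeg hφ, expNeg_logOneAdd]
    _ = expNeg (ENNReal.ofReal (lam * interferenceExponent α s)) := by
        rw [lintegral_one_sub_inv_one_add_mul_edist_rpow_plane hα hs,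
          ENNReal.ofReal_mul lam.coe_nonneg, ENNReal.ofReal_coe_nnreal]

/-- The total interference at `b` from the active devices `w.1.1` with fading gains `w.1.2` and the
active incumbents `w.2.1` of relative power `PI` with fading gains `w.2.2`. -/
noncomputable def interference (α : ℝ) (PI : ℝ≥0) (b : Plane)
    (w : (PointSeq × (ℕ → ℝ)) × PointSeq × (ℕ → ℝ)) : ℝ≥0∞ :=
  receivedPower α b w.1.1 w.1.2 + PI * receivedPower α b w.2.1 w.2.2

@[fun_prop]
lemma measurable_interference (α : ℝ) (PI : ℝ≥0) (b : Plane) :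
    Measurable (interference α PI b) := by
  have := measurable_receivedPower α b
  exact (this.comp measurable_fst).add ((this.comp measurable_snd).const_mul _)

lemma epsCoeff_mul_rpow {s : ℝ} (hs : 0 ≤ s) (PI : ℝ≥0) :
    epsCoeff α lam lamI PI * s ^ (2 / α) =
      lam * interferenceExponent α s + lamI * interferenceExponent α (s * PI) := by
  rw [epsCoeff, interferenceExponent, interferenceExponent, Real.mul_rpow hs PI.coe_nonneg]
  ring

lemma lintegral_expNeg_interference [IsFiniteMeasure P] (hΦ : IsHPPP lam Φ P)
    (hΦI : IsHPPP lamI ΦI P) (hf : IsExpFading f P) (hg : IsExpFading g P)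
    (hΦf : IndepFun Φ f P) (hΦIg : IndepFun ΦI g P)
    (hind : IndepFun (fun ω => (Φ ω, f ω)) (fun ω => (ΦI ω, g ω)) P) (hα : 2 < α) (PI : ℝ≥0)
    (b : Plane) {s : ℝ} (hs : 0 ≤ s) :
    ∫⁻ ω, expNeg (ENNReal.ofReal s * interference α PI b ((Φ ω, f ω), ΦI ω, g ω)) ∂P =
      expNeg (ENNReal.ofReal (epsCoeff α lam lamI PI * s ^ (2 / α))) := by
  have hsPI : 0 ≤ s * PI := by positivity
  have hm : ∀ t : ℝ≥0∞, Measurable fun p : PointSeq × (ℕ → ℝ) =>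
      expNeg (t * receivedPower α b p.1 p.2) := by fun_prop
  calc ∫⁻ ω, expNeg (ENNReal.ofReal s * interference α PI b ((Φ ω, f ω), ΦI ω, g ω)) ∂P
      = ∫⁻ ω, expNeg (ENNReal.ofReal s * receivedPower α b (Φ ω) (f ω)) *
          expNeg (ENNReal.ofReal (s * PI) * receivedPower α b (ΦI ω) (g ω)) ∂P := by
        simp only [interference, mul_add, expNeg_add, ENNReal.ofReal_mul hs,
          ENNReal.ofReal_coe_nnreal, mul_assoc]
    _ = (∫⁻ ω, expNeg (ENNReal.ofReal s * receivedPower α b (Φ ω) (f ω)) ∂P) *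
          ∫⁻ ω, expNeg (ENNReal.ofReal (s * PI) * receivedPower α b (ΦI ω) (g ω)) ∂P :=
        lintegral_mul_eq_lintegral_mul_lintegral_of_indepFun''
          ((hm _).comp (hΦ.measurable.prodMk hf.measurable)).aemeasurable
          ((hm _).comp (hΦI.measurable.prodMk hg.measurable)).aemeasurable
          (hind.comp (hm _) (hm _))
    _ = expNeg (ENNReal.ofReal (epsCoeff α lam lamI PI * s ^ (2 / α))) := by
        rw [lintegral_expNeg_receivedPower hΦ hf hΦf hα hs,
          lintegral_expNeg_receivedPower hΦI hg hΦIg hα hsPI, ← expNeg_add,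
          ← ENNReal.ofReal_add (mul_nonneg lam.coe_nonneg (interferenceExponent_nonneg hα hs))
            (mul_nonneg lamI.coe_nonneg (interferenceExponent_nonneg hα hsPI)),
          epsCoeff_mul_rpow hs]

end Interference

section DecodingProbability

variable {α τ : ℝ}

lemma psiCoeff_nonneg (hα : 2 < α) (hτ : 0 ≤ τ) (lam lamI PI : ℝ≥0) :
    0 ≤ psiCoeff α τ lam lamI PI := by
  have := sin_two_pi_div_pos hα
  have := Real.pi_pos
  unfold psiCoeff epsCoeff
  positivity

lemma psiCoeff_mul_sq (hα : α ≠ 0) (hτ : 0 ≤ τ) (lam lamI PI : ℝ≥0) {d : ℝ} (hd : 0 ≤ d) :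
    psiCoeff α τ lam lamI PI * d ^ 2 = epsCoeff α lam lamI PI * (τ * d ^ α) ^ (2 / α) := by
  rw [psiCoeff, Real.mul_rpow hτ (by positivity), ← Real.rpow_mul hd, mul_div_cancel₀ _ hα,
    Real.rpow_two, mul_assoc]

lemma ofReal_le_sinr_iff (hτ : 0 < τ) {b u : Plane} (hu : u ≠ b) {h : ℝ} (hh : 0 < h)
    (PN PI : ℝ≥0) (c c' : PointSeq) (f g : ℕ → ℝ) :
    ENNReal.ofReal τ ≤ sinr α PN PI b u h c f c' g ↔
      ENNReal.ofReal (τ * dist u b ^ α) * (PN + interference α PI b ((c, f), c', g)) ≤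
        ENNReal.ofReal h := by
  have hd : 0 < dist u b := dist_pos.2 hu
  have hd0 : ENNReal.ofReal (dist u b ^ α) ≠ 0 := by simpa using Real.rpow_pos_of_pos hd α
  have hh0 : ENNReal.ofReal h ≠ 0 := by simpa using hh
  rw [sinr, interference, ← add_assoc, edist_dist, ENNReal.rpow_neg,
    ENNReal.ofReal_rpow_of_pos hd, ENNReal.ofReal_mul hτ.le]
  generalize (PN : ℝ≥0∞) + _ + _ = D
  rcases eq_or_ne D ∞ with rfl | hD
  · simp [ENNReal.mul_top, hτ, Real.rpow_pos_of_pos hd]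
  · rw [ENNReal.le_div_iff_mul_le
      (.inr (mul_ne_zero hh0 (ENNReal.inv_ne_zero.2 ENNReal.ofReal_ne_top))) (.inl hD),
      ← div_eq_mul_inv, ENNReal.le_div_iff_mul_le (.inl hd0) (.inl ENNReal.ofReal_ne_top),
      mul_right_comm]

/-- The mean over the location `u ∼ ν` of the source of the probability of successful decoding at
`b` given `u`, as a function of the relative noise power `PN`. -/
noncomputable def meanDecodingProb (α τ ψ : ℝ) (b : Plane) (ν : Measure Plane) (PN : ℝ≥0) : ℝ :=
  (∫⁻ u, expNeg (ENNReal.ofReal (τ * dist u b ^ α) * PN + ENNReal.ofReal (ψ * dist u b ^ 2))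
    ∂ν).toReal

lemma meanDecodingProb_zero (α τ ψ : ℝ) (b : Plane) (ν : Measure Plane) :
    meanDecodingProb α τ ψ b ν 0 =
      (∫⁻ u, expNeg (ENNReal.ofReal (ψ * dist u b ^ 2)) ∂ν).toReal := by
  simp [meanDecodingProb]

lemma continuous_meanDecodingProb (α τ ψ : ℝ) (b : Plane) (ν : Measure Plane) [IsFiniteMeasure ν] :
    Continuous (meanDecodingProb α τ ψ b ν) := by
  have hfin : ∀ F : Plane → ℝ≥0∞, ∫⁻ u, expNeg (F u) ∂ν ≠ ∞ := fun F =>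
    ((lintegral_mono fun _ => expNeg_le_one _).trans_lt (by simp)).ne
  refine continuous_iff_continuousAt.2 fun PN => (ENNReal.tendsto_toReal (hfin _)).comp
    (tendsto_lintegral_expNeg (fun _ => by fun_prop) fun u => ?_)
  exact (((ENNReal.continuous_const_mul ENNReal.ofReal_ne_top).comp
    ENNReal.continuous_coe).add continuous_const).tendsto PN

lemma adp_eq_meanDecodingProb {Ω : Type*} [MeasurableSpace Ω] {P : Measure Ω} [IsFiniteMeasure P]
    (hα : 2 < α) (hτ : 0 < τ) {lam lamI : ℝ≥0} (PN PI : ℝ≥0) {b : Plane}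
    {U : Ω → Plane} (hU : Measurable U) (hUb : ∀ᵐ ω ∂P, U ω ≠ b)
    {h : Ω → ℝ} (hh : Measurable h) (hhlaw : HasLaw h (expMeasure 1) P)
    {Φ ΦI : Ω → PointSeq} (hΦ : IsHPPP lam Φ P) (hΦI : IsHPPP lamI ΦI P)
    {f g : Ω → ℕ → ℝ} (hf : IsExpFading f P) (hg : IsExpFading g P)
    (hindep : iIndep ![MeasurableSpace.comap U inferInstance, MeasurableSpace.comap h inferInstance,
      MeasurableSpace.comap Φ inferInstance, MeasurableSpace.comap f inferInstance,
      MeasurableSpace.comap ΦI inferInstance, MeasurableSpace.comap g inferInstance] P) :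
    adp P α τ PN PI b U h Φ f ΦI g =
      meanDecodingProb α τ (psiCoeff α τ lam lamI PI) b (P.map U) PN := by
  obtain ⟨hUWh, hUW, hΦfΦIg, hΦf, hΦIg⟩ := indepFun_prodMk_of_iIndep_six hU hh hΦ.measurable
    hf.measurable hΦI.measurable hg.measurable hindep
  have hW := (hΦ.measurable.prodMk hf.measurable).prodMk (hΦI.measurable.prodMk hg.measurable)
  let threshold : Plane × (PointSeq × (ℕ → ℝ)) × PointSeq × (ℕ → ℝ) → ℝ≥0∞ := fun p =>
    ENNReal.ofReal (τ * dist p.1 b ^ α) * (PN + interference α PI b p.2)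
  have hthr : Measurable threshold := by fun_prop
  have hh0 : ∀ᵐ ω ∂P, 0 < h ω :=
    ae_of_ae_map hh.aemeasurable (hhlaw.map_eq ▸ ae_pos_expMeasure one_pos)
  have hevent : {ω | ENNReal.ofReal τ ≤ sinr α PN PI b (U ω) (h ω) (Φ ω) (f ω) (ΦI ω) (g ω)} =ᵐ[P]
      {ω | threshold (U ω, (Φ ω, f ω), ΦI ω, g ω) ≤ ENNReal.ofReal (h ω)} := by
    filter_upwards [hUb, hh0] with ω hω hhω
    exact propext (ofReal_le_sinr_iff hτ hω hhω PN PI _ _ _ _)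
  rw [adp, Measure.real, meanDecodingProb]
  congr 1
  calc P {ω | ENNReal.ofReal τ ≤ sinr α PN PI b (U ω) (h ω) (Φ ω) (f ω) (ΦI ω) (g ω)}
      = P {ω | threshold (U ω, (Φ ω, f ω), ΦI ω, g ω) ≤ ENNReal.ofReal (h ω)} :=
        measure_congr hevent
    _ = ∫⁻ ω, expNeg (threshold (U ω, (Φ ω, f ω), ΦI ω, g ω)) ∂P := by
        simpa using measure_le_ofReal_of_indepFun one_pos (hthr.comp (hU.prodMk hW)) hh hhlaw
          (hUWh.comp hthr measurable_id)
    _ = ∫⁻ u, ∫⁻ ω, expNeg (threshold (u, (Φ ω, f ω), ΦI ω, g ω)) ∂P ∂(P.map U) :=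
        lintegral_comp_prodMk_of_indepFun hU hW hUW (measurable_expNeg.comp hthr)
    _ = ∫⁻ u, expNeg (ENNReal.ofReal (τ * dist u b ^ α) * PN +
          ENNReal.ofReal (psiCoeff α τ lam lamI PI * dist u b ^ 2)) ∂(P.map U) := by
        refine lintegral_congr fun u => ?_
        simp only [threshold, mul_add, expNeg_add]
        rw [lintegral_const_mul' _ _ ((expNeg_le_one _).trans_lt ENNReal.one_lt_top).ne,
          lintegral_expNeg_interference hΦ hΦI hf hg hΦf hΦIg hΦfΦIg hα PI b (by positivity),
          psiCoeff_mul_sq (by positivity) hτ.le _ _ _ dist_nonneg]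

end DecodingProbability

section PolarIntegral

variable {ψ : ℝ} {A : Set Plane}

lemma measurable_adpIntegrand (ψ : ℝ) (A : Set Plane) (pb θb : ℝ) :
    Measurable (adpIntegrand ψ A pb θb) := by
  unfold adpIntegrand cosineDistSq
  fun_prop

lemma adpIntegrand_nonneg (ψ : ℝ) (A : Set Plane) (pb θb : ℝ) {q : ℝ × ℝ} (hq : 0 ≤ q.1) :
    0 ≤ adpIntegrand ψ A pb θb q :=
  mul_nonneg (Real.exp_pos _).le (div_nonneg hq measureReal_nonneg)

lemma setLIntegral_adpIntegrand (hψ : 0 ≤ ψ) (hA : MeasurableSet A) (hA0 : volume A ≠ 0)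
    (hAtop : volume A ≠ ∞) (pb θb : ℝ) :
    ∫⁻ q in polarRegion A, ENNReal.ofReal (adpIntegrand ψ A pb θb q) =
      ∫⁻ u, expNeg (ENNReal.ofReal (ψ * dist u (polarPoint pb θb) ^ 2)) ∂(cond volume A) := by
  have hv : 0 < volume.real A := ENNReal.toReal_pos hA0 hAtop
  rw [ProbabilityTheory.cond, lintegral_smul_measure, setLIntegral_eq_polarRegion hA, smul_eq_mul,
    ← lintegral_const_mul' _ _ (ENNReal.inv_ne_top.2 hA0)]
  refine setLIntegral_congr_fun (measurableSet_polarRegion hA) fun q _ => ?_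
  rw [expNeg_ofReal (by positivity), dist_polarPoint_sq, adpIntegrand,
    ENNReal.ofReal_mul (Real.exp_pos _).le, ENNReal.ofReal_div_of_pos hv, neg_mul,
    ofReal_measureReal hAtop, div_eq_mul_inv]
  ring

lemma ae_polarRegion_adpIntegrand_nonneg (ψ : ℝ) (hA : MeasurableSet A) (pb θb : ℝ) :
    0 ≤ᵐ[volume.restrict (polarRegion A)] adpIntegrand ψ A pb θb := by
  filter_upwards [self_mem_ae_restrict (measurableSet_polarRegion hA)] with q hq
  exact adpIntegrand_nonneg ψ A pb θb hq.1.le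

lemma integrableOn_adpIntegrand (hψ : 0 ≤ ψ) (hA : MeasurableSet A) (hA0 : volume A ≠ 0)
    (hAtop : volume A ≠ ∞) (pb θb : ℝ) :
    IntegrableOn (adpIntegrand ψ A pb θb) (polarRegion A) := by
  refine ⟨(measurable_adpIntegrand ψ A pb θb).aestronglyMeasurable, ?_⟩
  rw [hasFiniteIntegral_iff_ofReal (ae_polarRegion_adpIntegrand_nonneg ψ hA pb θb),
    setLIntegral_adpIntegrand hψ hA hA0 hAtop]
  exact (lintegral_mono fun _ => expNeg_le_one _).trans_lt (by simp)

lemma integral_adpIntegrand (hψ : 0 ≤ ψ) (hA : MeasurableSet A) (hA0 : volume A ≠ 0)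
    (hAtop : volume A ≠ ∞) (α τ pb θb : ℝ) :
    ∫ q in polarRegion A, adpIntegrand ψ A pb θb q =
      meanDecodingProb α τ ψ (polarPoint pb θb) (cond volume A) 0 := by
  rw [integral_eq_lintegral_of_nonneg_ae (ae_polarRegion_adpIntegrand_nonneg ψ hA pb θb)
      (measurable_adpIntegrand ψ A pb θb).aestronglyMeasurable,
    setLIntegral_adpIntegrand hψ hA hA0 hAtop, meanDecodingProb_zero]

end PolarIntegral

theorem theorem2
    {Ω : Type*} [MeasurableSpace Ω] (P : Measure Ω) [IsProbabilityMeasure P]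
    -- path-loss exponent, decoding threshold, densities, relative incumbent power
    (α τ : ℝ) (hα : 2 < α) (hτ : 0 < τ) (lam lamI PI : ℝ≥0)
    -- area
    (A : Set Plane) (hA : MeasurableSet A) (hA0 : volume A ≠ 0) (hAtop : volume A ≠ ∞)
    -- polar coordinates of the receiver
    (pb θb : ℝ) (hpb : 0 ≤ pb)
    -- source location and its fading gain
    (U : Ω → Plane) (hU : Measurable U) (hUunif : pdf.IsUniform U A P volume)
    (h : Ω → ℝ) (hh : Measurable h) (hhlaw : HasLaw h (expMeasure 1) P)
    -- active IoT devices and incumbents, with their fading gains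
    (Φ ΦI : Ω → PointSeq) (hΦ : IsHPPP lam Φ P) (hΦI : IsHPPP lamI ΦI P)
    (f g : Ω → ℕ → ℝ) (hf : IsExpFading f P) (hg : IsExpFading g P)
    -- the six random objects are independent
    (hindep : iIndep ![MeasurableSpace.comap U inferInstance, MeasurableSpace.comap h inferInstance,
      MeasurableSpace.comap Φ inferInstance, MeasurableSpace.comap f inferInstance,
      MeasurableSpace.comap ΦI inferInstance, MeasurableSpace.comap g inferInstance] P) :
    -- law of cosines
    (∀ r θ : ℝ, dist (polarPoint r θ) (polarPoint pb θb) ^ 2 = cosineDistSq r θ pb θb) ∧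
    -- the integral converges
    IntegrableOn (adpIntegrand (psiCoeff α τ lam lamI PI) A pb θb) (polarRegion A) ∧
    -- the formula without noise
    adp P α τ 0 PI (polarPoint pb θb) U h Φ f ΦI g =
      ∫ q in polarRegion A, adpIntegrand (psiCoeff α τ lam lamI PI) A pb θb q ∧
    -- the formula in the limit of vanishing noise power
    Tendsto (fun PN : ℝ≥0 => adp P α τ PN PI (polarPoint pb θb) U h Φ f ΦI g) (𝓝[>] 0)
      (𝓝 (∫ q in polarRegion A, adpIntegrand (psiCoeff α τ lam lamI PI) A pb θb q)) := by
  have hψ : 0 ≤ psiCoeff α τ lam lamI PI := psiCoeff_nonneg hα hτ.le lam lamI PI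
  have hmap : P.map U = cond volume A := hUunif
  have : IsFiniteMeasure (cond volume A) := hmap ▸ inferInstance
  have hUb : ∀ᵐ ω ∂P, U ω ≠ polarPoint pb θb := ae_of_ae_map hU.aemeasurable
    (hUunif.absolutelyContinuous.ae_le (Measure.ae_ne volume (polarPoint pb θb)))
  have hadp : ∀ PN : ℝ≥0, adp P α τ PN PI (polarPoint pb θb) U h Φ f ΦI g =
      meanDecodingProb α τ (psiCoeff α τ lam lamI PI) (polarPoint pb θb) (cond volume A) PN :=
    fun PN => hmap ▸ adp_eq_meanDecodingProb hα hτ PN PI hU hUb hh hhlaw hΦ hΦI hf hg hindep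
  have hint := integral_adpIntegrand hψ hA hA0 hAtop α τ pb θb
  refine ⟨fun r θ => dist_polarPoint_sq r θ pb θb,
    integrableOn_adpIntegrand hψ hA hA0 hAtop pb θb, (hadp 0).trans hint.symm, ?_⟩
  simpa only [hadp, hint] using
    ((continuous_meanDecodingProb α τ _ _ _).tendsto 0).mono_left nhdsWithin_le_nhds
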